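/- **Theorem ($q$-secant numbers).** For $m\ge 0$ and a permutation $\sigma=\sigma_1\cdots\sigma_m\in\mathfrak S_m$, let $D(\sigma)=\{i\in\{1,\dots,m-1\}:\sigma_i>\sigma_{i+1}\}$ be its descent set and $\operatorname{maj}(\sigma)=\sum_{i\in D(\sigma)}i$ its major index. Let $\mathrm{Alt}_m$ be the set of alternating permutations, i.e. those with $D(\sigma)=\{1,3,\dots,2\lfloor m/2\rfloor-1\}$, and $\mathrm{RevAlt}_m$ the set of reverse alternating permutations, i.e. those with $D(\sigma)=\{2,4,\dots,2\lceil m/2\rceil-2\}$. Put $$E_m(q)=\sum_{\sigma\in\mathrm{RevAlt}_m}q^{\operatorname{maj}(\sigma^{-1})},\qquad E^*_m(q)=\sum_{\sigma\in\mathrm{Alt}_m}q^{\operatorname{maj}(\sigma^{-1})},\qquad (a;q)_m=\prod_{i=0}^{m-1}(1-aq^i).$$ Let $\mathcal D_n$ be the set of Dyck paths of length $2n$, written as sequences of heights $(h_0,h_1,\dots,h_{2n})$ of nonnegative integers with $h_0=h_{2n}=0$ and $|h_i-h_{i+1}|=1$ for all $0\le i<2n$, and let $\delta_{i,j}$ be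 the Kronecker delta. Let $K$ be a field, $n\ge 0$ an integer, and $q\in K$ such that $q^k\neq 1$ for $1\le k\le 2n$ (for instance, $q$ an indeterminate over $\mathbb Q$, with $K=\mathbb Q(q)$, or $q$ a real number with $|q|<1$). Then $$\sum_{(h_0,\dots,h_{2n})\in\mathcal D_n}\ \prod_{i=1}^{2n}\frac{q^{h_i}}{1-q^{2h_i+1-\delta_{h_i,i}}}=\frac{E^*_{2n}(q)}{(q;q)_{2n}}$$ and $$\sum_{(h_0,\dots,h_{2n})\in\mathcal D_n}\ \prod_{i=1}^{2n}\frac{q^{h_i-\delta_{h_i,i}}}{1-q^{2h_i+1-\delta_{h_i,i}}}=\frac{E_{2n}(q)}{(q;q)_{2n}}.$$ -/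

import Mathlib

/-- The descent set `D(σ)` of a permutation of `{1, …, n}` written in one-line notation
`σ_1 ⋯ σ_n`: the set of `i ∈ {1, …, n - 1}` with `σ_i > σ_{i+1}`.
The letter `σ_{i+1}` is the value of `σ` at the element `i` of `Fin n`. -/
def permDescents {n : ℕ} (σ : Equiv.Perm (Fin n)) : Finset ℕ :=
  (Finset.range n).filter fun i =>
    ∃ (_ : 1 ≤ i) (h : i < n), σ ⟨i, h⟩ < σ ⟨i - 1, lt_of_le_of_lt (Nat.sub_le i 1) h⟩

/-- The major index: the sum of the descents. -/
def permMaj {n : ℕ} (σ : Equiv.Perm (Fin n)) : ℕ :=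
  ∑ i ∈ permDescents σ, i

/-- Alternating permutations: `D(σ) = {1, 3, …, 2⌊n/2⌋ - 1}`. -/
def IsAltPerm {n : ℕ} (σ : Equiv.Perm (Fin n)) : Prop :=
  permDescents σ = (Finset.range (n / 2)).image fun k => 2 * k + 1

/-- Reverse alternating permutations: `D(σ) = {2, 4, …, 2⌈n/2⌉ - 2}`. -/
def IsRevAltPerm {n : ℕ} (σ : Equiv.Perm (Fin n)) : Prop :=
  permDescents σ = (Finset.range ((n + 1) / 2 - 1)).image fun k => 2 * k + 2

instance {n : ℕ} : DecidablePred (IsAltPerm (n := n)) := fun σ =>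
  inferInstanceAs (Decidable (permDescents σ = _))

instance {n : ℕ} : DecidablePred (IsRevAltPerm (n := n)) := fun σ =>
  inferInstanceAs (Decidable (permDescents σ = _))

/-- `E_n(q) = ∑ q ^ maj(σ⁻¹)`, the sum over reverse alternating permutations `σ`. -/
def qEuler {K : Type*} [Field K] (n : ℕ) (q : K) : K :=
  ∑ σ : Equiv.Perm (Fin n) with IsRevAltPerm σ, q ^ permMaj σ⁻¹

/-- `E*_n(q) = ∑ q ^ maj(σ⁻¹)`, the sum over alternating permutations `σ`. -/
def qEulerStar {K : Type*} [Field K] (n : ℕ) (q : K) : K :=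
  ∑ σ : Equiv.Perm (Fin n) with IsAltPerm σ, q ^ permMaj σ⁻¹

/-- The `q`-Pochhammer symbol `(a; q)_n = ∏_{i=0}^{n-1} (1 - a q^i)`. -/
def qPoch {K : Type*} [Field K] (a q : K) (n : ℕ) : K :=
  ∏ i ∈ Finset.range n, (1 - a * q ^ i)

/-- The height `h_i` that a Dyck path reaches after `i` steps: up steps minus down steps among
the first `i` steps (a Dyck word never has more down steps than up steps in a prefix, so the
subtraction does not truncate). -/
def dyckHeight (d : DyckWord) (i : ℕ) : ℕ :=
  (d.toList.take i).count DyckStep.U - (d.toList.take i).count DyckStep.D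

/-- The Kronecker delta, as a natural number. -/
def kroneckerDelta (i j : ℕ) : ℕ := if i = j then 1 else 0

/-!
Both sides of each identity are coefficients of the reciprocal of the same power series, a
`q`-analogue of the cosine: `∑ (-1)^k x^{2k} / (q; q)_{2k}` for the reverse alternating
permutations, and the same with an extra factor `q ^ (2k choose 2)` for the alternating ones. Since
`q` may be a root of unity of order larger than `2n`, the series are handled through their first
coefficients only, as finite convolutions.

*Permutations.* Reading `σ` through the one-line notation of `σ⁻¹` turns the descents of `σ` into
conditions on the relative order of the letters `j` and `j + 1`, and `maj σ⁻¹` into the major index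
of a word. If no condition is put on one pair `a - 1, a`, the words are the shuffles of a word on
the letters below `a` with one on the other letters, and by the shuffle theorem for the major index
(`sum_revMaj_shuffles`) the generating function factors with a Gaussian binomial
(`sum_free_pair`). An alternating sum over the length of an initial block of constant pattern then
telescopes (`sum_range_patternSum`), which is the asserted reciprocity.

*Dyck paths.* The Kronecker delta changes the weight only on the initial run of up steps. The sums
over the remaining part of a path, from height `h` to `0`, obey a three-term recursion in `h`.
Multiplied by the `q`-cosine they have closed forms (`tailCoeff`), `q`-analogues of the coefficients
of spherical Bessel functions; `signed_conv_pathSum` says that the recursion determines them. The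
initial run satisfies a similar recursion with the closed form `diagCoeff`, whose value at height
`1` is the `q`-cosine again (`diagCoeff_zero_left`), and this is the same reciprocity. The weights
off the diagonal are the same in both identities because the recursion has two solutions, belonging
to the two `q`-cosines (`ε = 0` and `ε = 1`).
-/

/-! ### The major index on shuffles -/

/-- The major index of the word obtained by reading the list from its end to its head. Reading
backwards makes appending a last letter to a word a `cons`. -/
def revMaj : List ℕ → ℕ
  | [] => 0
  | [_] => 0
  | x :: y :: l => revMaj (y :: l) + if x < y then l.length + 1 else 0

/-- The words that are shuffles of two given words. -/
def shuffles : List ℕ → List ℕ → Finset (List ℕ)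
  | [], v => {v}
  | a :: u, [] => {a :: u}
  | a :: u, b :: v =>
      (shuffles u (b :: v)).image (List.cons a) ∪ (shuffles (a :: u) v).image (List.cons b)

theorem shuffles_nil_right (u : List ℕ) : shuffles u [] = {u} := by
  cases u <;> simp [shuffles]

theorem shuffles_comm (u v : List ℕ) : shuffles u v = shuffles v u := by
  induction u generalizing v with
  | nil => simp [shuffles, shuffles_nil_right]
  | cons a u ihu =>
    induction v with
    | nil => simp [shuffles]
    | cons b v ihv => rw [shuffles, shuffles, ihu, ihv, Finset.union_comm]

theorem sum_shuffles_cons_cons {M : Type*} [AddCommMonoid M] {a b : ℕ} (hab : a ≠ b)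
    (u v : List ℕ) (f : List ℕ → M) :
    ∑ w ∈ shuffles (a :: u) (b :: v), f w =
      ∑ w ∈ shuffles u (b :: v), f (a :: w) + ∑ w ∈ shuffles (a :: u) v, f (b :: w) := by
  rw [shuffles, Finset.sum_union, Finset.sum_image, Finset.sum_image]
  · intro x _ y _ h; exact (List.cons.inj h).2
  · intro x _ y _ h; exact (List.cons.inj h).2
  · rw [Finset.disjoint_left]
    intro w h1 h2
    simp only [Finset.mem_image] at h1 h2
    obtain ⟨x, -, rfl⟩ := h1
    obtain ⟨y, -, h⟩ := h2
    exact hab (List.cons.inj h).1.symm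

theorem length_of_mem_shuffles {u v w : List ℕ} (hw : w ∈ shuffles u v) :
    w.length = u.length + v.length := by
  induction u generalizing v w with
  | nil => simp_all [shuffles]
  | cons a u ihu =>
    induction v generalizing w with
    | nil => simp_all [shuffles]
    | cons b v ihv =>
      simp only [shuffles, Finset.mem_union, Finset.mem_image] at hw
      rcases hw with ⟨x, hx, rfl⟩ | ⟨x, hx, rfl⟩
      · have := ihu hx
        simp at this ⊢; omega
      · have := ihv hx
        simp at this ⊢; omega

/-- If `u` and `v` are the two subwords of `w` cut out by a predicate, then `w` is a shuffle of
them, and conversely. -/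
theorem mem_shuffles_iff_filter {p : ℕ → Bool} {u v w : List ℕ} (hu : ∀ x ∈ u, p x = true)
    (hv : ∀ x ∈ v, p x = false) :
    w ∈ shuffles u v ↔ w.filter p = u ∧ w.filter (fun x => !p x) = v := by
  induction w generalizing u v with
  | nil =>
    rcases u with _ | ⟨a, u⟩ <;> rcases v with _ | ⟨b, v⟩ <;> simp [shuffles]
  | cons c w ih =>
    rcases u with _ | ⟨a, u⟩ <;> rcases v with _ | ⟨b, v⟩
    · simp [shuffles]
      intro h; simp [h]
    · have hb : p b = false := hv b (by simp)
      have key := ih (u := []) (v := v) (by simp) (fun x hx => hv x (by simp [hx]))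
      simp only [shuffles, Finset.mem_singleton] at key ⊢
      by_cases hc : p c = true
      · simp only [List.filter_cons, hc]
        simp
        rintro rfl; simp [hb] at hc
      · simp only [Bool.not_eq_true] at hc
        simp [hc, List.cons.injEq, key]
        tauto
    · have ha : p a = true := hu a (by simp)
      have key := ih (u := u) (v := []) (fun x hx => hu x (by simp [hx])) (by simp)
      simp only [shuffles_nil_right, Finset.mem_singleton] at key ⊢
      by_cases hc : p c = true
      · simp only [List.filter_cons, hc, List.cons.injEq, key]
        simp
        tauto
      · simp only [Bool.not_eq_true] at hc
        simp [hc]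
        rintro rfl; simp [ha] at hc
    · have ha : p a = true := hu a (by simp)
      have hb : p b = false := hv b (by simp)
      have k1 := ih (u := u) (v := b :: v) (fun x hx => hu x (by simp [hx])) hv
      have k2 := ih (u := a :: u) (v := v) hu (fun x hx => hv x (by simp [hx]))
      have hab : a ≠ b := by rintro rfl; simp [ha] at hb
      simp only [shuffles, Finset.mem_union, Finset.mem_image, List.cons.injEq]
      by_cases hc : p c = true
      · have hcb : b ≠ c := by rintro rfl; simp [hc] at hb
        simp only [List.filter_cons, hc]
        simp [hcb, k1, @eq_comm _ a c]
        tauto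
      · simp only [Bool.not_eq_true] at hc
        have hca : a ≠ c := by rintro rfl; simp [hc] at ha
        simp only [List.filter_cons, hc]
        simp [hca, k2, @eq_comm _ b c]
        tauto

section

variable {K : Type*} [Field K]

theorem qPoch_succ (q : K) (n : ℕ) : qPoch q q (n + 1) = qPoch q q n * (1 - q ^ (n + 1)) := by
  rw [qPoch, Finset.prod_range_succ, ← qPoch, pow_succ' q n]

/-- Shuffles of `a :: u` and `b :: v` in which `a` comes last in the word (first in the list),
counted by major index. This refinement of the shuffle theorem can be proved by induction: removing
`a` leaves shuffles whose last letter, `b` or the letter of `u` before `a`, decides whether a descent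
is lost. -/
theorem sum_revMaj_shuffles_cons (q : K) (a b : ℕ) (u v : List ℕ)
    (h : ∀ x ∈ a :: u, ∀ y ∈ b :: v, x ≠ y) :
    qPoch q q (u.length + 1) * qPoch q q (v.length + 1) *
        ∑ w ∈ shuffles u (b :: v), q ^ revMaj (a :: w) =
      q ^ (if a < b then v.length + 1 else 0) * (1 - q ^ (u.length + 1)) *
        qPoch q q (u.length + v.length + 1) * q ^ (revMaj (a :: u) + revMaj (b :: v)) := by
  induction hn : u.length + v.length using Nat.strong_induction_on generalizing a b u v with
  | _ n ih =>
  subst hn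
  rcases u with _ | ⟨c, u⟩
  · simp only [shuffles, Finset.sum_singleton, List.length_nil, revMaj, zero_add]
    have h1 : qPoch q q 1 = 1 - q ^ 1 := by simp [qPoch]
    rw [h1]
    split_ifs <;> ring
  · have hcb : c ≠ b := h c (by simp) b (by simp)
    have hab : a ≠ b := h a (by simp) b (by simp)
    have h1 := ih _ (by simp) c b u v (fun x hx y hy => h x (by simp_all) y hy) rfl
    have h2 := ih _ (by simp; omega) b c v u
      (fun x hx y hy => (h y (by simp_all) x hx).symm) rfl
    rw [sum_shuffles_cons_cons hcb, shuffles_comm (c :: u) v]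
    have e1 : ∑ w ∈ shuffles u (b :: v), q ^ revMaj (a :: c :: w) =
        q ^ (if a < c then u.length + v.length + 2 else 0) *
          ∑ w ∈ shuffles u (b :: v), q ^ revMaj (c :: w) := by
      rw [Finset.mul_sum]
      refine Finset.sum_congr rfl fun w hw => ?_
      have := length_of_mem_shuffles hw
      rw [List.length_cons] at this
      rw [revMaj, this, pow_add, mul_comm]
      rfl
    have e2 : ∑ w ∈ shuffles v (c :: u), q ^ revMaj (a :: b :: w) =
        q ^ (if a < b then u.length + v.length + 2 else 0) *
          ∑ w ∈ shuffles v (c :: u), q ^ revMaj (b :: w) := by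
      rw [Finset.mul_sum]
      refine Finset.sum_congr rfl fun w hw => ?_
      have := length_of_mem_shuffles hw
      rw [List.length_cons] at this
      rw [revMaj, this, pow_add, mul_comm,
        show v.length + (u.length + 1) + 1 = u.length + v.length + 2 by ring]
    rw [e1, e2, revMaj]
    simp only [List.length_cons]
    rw [show u.length + 1 + v.length + 1 = (u.length + v.length + 1) + 1 by ring,
      qPoch_succ q (u.length + 1), qPoch_succ q (u.length + v.length + 1)]
    rw [show v.length + u.length + 1 = u.length + v.length + 1 by ring] at h2
    set X := ∑ w ∈ shuffles u (b :: v), q ^ revMaj (c :: w)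
    set Y := ∑ w ∈ shuffles v (c :: u), q ^ revMaj (b :: w)
    -- The first factor comes from passing from `(q; q)_{|u|+1}` to `(q; q)_{|u|+2}`; the rest is a
    -- combination of the two sums known by induction.
    calc _ = (1 - q ^ (u.length + 1 + 1)) * (q ^ (if a < c then u.length + v.length + 2 else 0) *
              (qPoch q q (u.length + 1) * qPoch q q (v.length + 1) * X) +
            q ^ (if a < b then u.length + v.length + 2 else 0) *
              (qPoch q q (v.length + 1) * qPoch q q (u.length + 1) * Y)) := by ring
      _ = _ := by
        rw [h1, h2]
        rcases lt_or_gt_of_ne hcb with h3 | h3 <;> rcases lt_or_gt_of_ne hab with h4 | h4 <;>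
          rcases lt_or_ge a c with h5 | h5 <;>
          first
          | omega
          | (simp only [h3, h4, h5, if_true, if_false, h3.not_gt, h4.not_gt, h5.not_gt]; ring)

/-- **The shuffle theorem** for the major index: the shuffles of two words of lengths `a` and `b`
without common letters have generating function `q ^ (maj u + maj v)` times the Gaussian binomial
`(q; q)_{a+b} / ((q; q)_a (q; q)_b)`. -/
theorem sum_revMaj_shuffles (q : K) (u v : List ℕ) (h : ∀ x ∈ u, ∀ y ∈ v, x ≠ y) :
    qPoch q q u.length * qPoch q q v.length * ∑ w ∈ shuffles u v, q ^ revMaj w =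
      qPoch q q (u.length + v.length) * q ^ (revMaj u + revMaj v) := by
  rcases u with _ | ⟨a, u⟩
  · simp [shuffles, qPoch, revMaj]
  rcases v with _ | ⟨b, v⟩
  · simp [shuffles, qPoch, revMaj]
  have hab : a ≠ b := h a (by simp) b (by simp)
  rw [sum_shuffles_cons_cons hab, shuffles_comm (a :: u) v]
  have h1 := sum_revMaj_shuffles_cons q a b u v h
  have h2 := sum_revMaj_shuffles_cons q b a v u (fun x hx y hy => (h y hy x hx).symm)
  simp only [List.length_cons]
  rw [show u.length + 1 + (v.length + 1) = (u.length + v.length + 1) + 1 by ring,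
    qPoch_succ q (u.length + v.length + 1), mul_add, h1,
    mul_comm (qPoch q q (u.length + 1)), h2]
  rw [show v.length + u.length + 1 = u.length + v.length + 1 by ring]
  rcases lt_or_gt_of_ne hab with h3 | h3 <;>
    (simp only [h3, if_true, if_false, h3.not_gt]; ring)

end

/-! ### Words with prescribed inverse descents -/

/-- The words in which each of the letters `0, …, m - 1` occurs exactly once. -/
def permWords (m : ℕ) : Finset (List ℕ) := (List.range m).permutations.toFinset

theorem mem_permWords {m : ℕ} {w : List ℕ} : w ∈ permWords m ↔ w.Perm (List.range m) := by
  simp [permWords]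

/-- `HasPattern m r w` says that for all `j + 1 < m` the letter `j + 1` precedes `j` in the word
that `w` spells backwards exactly when `r j` holds. -/
def HasPattern (m : ℕ) (r : ℕ → Prop) (w : List ℕ) : Prop :=
  ∀ j, j + 1 < m → (r j ↔ [j, j + 1].Sublist w)

open Classical in
/-- The words on `0, …, m - 1` of pattern `r`, counted by major index. -/
noncomputable def patternSum {K : Type*} [Field K] (m : ℕ) (r : ℕ → Prop) (q : K) : K :=
  ∑ w ∈ permWords m with HasPattern m r w, q ^ revMaj w

theorem pair_sublist_filter_iff {p : ℕ → Bool} {x y : ℕ} (hx : p x = true) (hy : p y = true)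
    (w : List ℕ) : [x, y].Sublist (w.filter p) ↔ [x, y].Sublist w := by
  refine ⟨fun h => h.trans List.filter_sublist, fun h => ?_⟩
  simpa [hx, hy] using h.filter p

theorem pair_sublist_map_iff {f : ℕ → ℕ} (hf : f.Injective) (x y : ℕ) (w : List ℕ) :
    [f x, f y].Sublist (w.map f) ↔ [x, y].Sublist w := by
  refine ⟨fun h => ?_, fun h => by simpa using h.map f⟩
  obtain ⟨l, hl, h⟩ := List.sublist_map_iff.1 h
  have : l = [x, y] := List.map_injective_iff.2 hf (by simpa using h.symm)
  exact this ▸ hl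

theorem revMaj_map_add (a : ℕ) (w : List ℕ) : revMaj (w.map (a + ·)) = revMaj w := by
  match w with
  | [] => rfl
  | [_] => rfl
  | x :: y :: l =>
    have := revMaj_map_add a (y :: l)
    simp only [List.map_cons] at this ⊢
    simp [revMaj, this]

/-- Splitting a word into its letters below `a` and the remaining letters, shifted down by `a`. -/
def splitWord (a : ℕ) (w : List ℕ) : List ℕ × List ℕ :=
  (w.filter (· < a), (w.filter (fun x => !decide (x < a))).map (· - a))

theorem map_add_map_sub {a : ℕ} {v : List ℕ} (hv : ∀ x ∈ v, a ≤ x) :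
    (v.map (· - a)).map (a + ·) = v := by
  rw [List.map_map]
  conv_rhs => rw [← List.map_id v]
  refine List.map_congr_left fun x hx => ?_
  have := hv x hx
  simp; omega

theorem splitWord_eq_iff {a : ℕ} {u v w : List ℕ} (hu : ∀ x ∈ u, x < a) :
    splitWord a w = (u, v) ↔ w ∈ shuffles u (v.map (a + ·)) := by
  rw [mem_shuffles_iff_filter (p := fun x => decide (x < a)) (by simpa using hu) (by simp),
    splitWord, Prod.mk.injEq]
  refine and_congr_right fun _ => ⟨?_, ?_⟩
  · rintro rfl
    rw [map_add_map_sub]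
    simp
  · intro h
    rw [h, List.map_map]
    conv_rhs => rw [← List.map_id v]
    exact List.map_congr_left fun x _ => by simp

theorem mem_permWords_add_iff {a b : ℕ} {w : List ℕ} :
    w ∈ permWords (a + b) ↔
      (splitWord a w).1 ∈ permWords a ∧ (splitWord a w).2 ∈ permWords b := by
  have e1 : (List.range (a + b)).filter (fun x => decide (x < a)) = List.range a := by
    rw [List.range_add, List.filter_append, List.filter_eq_self.2, List.filter_eq_nil_iff.2] <;>
      simp
  have e2 : (List.range (a + b)).filter (fun x => !decide (x < a)) =
      (List.range b).map (a + ·) := by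
    rw [List.range_add, List.filter_append, List.filter_eq_nil_iff.2, List.filter_eq_self.2] <;>
      simp
  simp only [mem_permWords, splitWord]
  constructor
  · intro h
    refine ⟨e1 ▸ h.filter _, ?_⟩
    have h2 := (h.filter (fun x => !decide (x < a))).map (· - a)
    rw [e2, List.map_map] at h2
    convert h2
    conv_lhs => rw [← List.map_id (List.range b)]
    exact List.map_congr_left fun x _ => by simp
  · rintro ⟨h1, h2⟩
    have h3 := h2.map (a + ·)
    rw [map_add_map_sub (by simp), ← e2] at h3
    rw [← e1] at h1
    exact (List.filter_append_perm (fun x => decide (x < a)) w).symm.trans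
      ((h1.append h3).trans (List.filter_append_perm _ _))

theorem hasPattern_splitWord {a b : ℕ} {r : ℕ → Prop} {w : List ℕ} :
    (∀ j, j + 1 < a + b → j + 1 ≠ a → (r j ↔ [j, j + 1].Sublist w)) ↔
      HasPattern a r (splitWord a w).1 ∧ HasPattern b (fun j => r (a + j)) (splitWord a w).2 := by
  have e1 : ∀ j, j + 1 < a → ([j, j + 1].Sublist (splitWord a w).1 ↔ [j, j + 1].Sublist w) :=
    fun j hj => pair_sublist_filter_iff (by simp; omega) (by simp; omega) w
  have e2 : ∀ j, [j, j + 1].Sublist (splitWord a w).2 ↔ [a + j, a + j + 1].Sublist w := by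
    intro j
    rw [← pair_sublist_map_iff (add_right_injective a) j (j + 1), splitWord,
      map_add_map_sub (by simp)]
    exact pair_sublist_filter_iff (by simp) (by simp) w
  constructor
  · intro h
    refine ⟨fun j hj => ?_, fun j hj => ?_⟩
    · rw [e1 j hj]; exact h j (by omega) (by omega)
    · rw [e2]; exact h (a + j) (by omega) (by omega)
  · rintro ⟨h1, h2⟩ j hj hja
    rcases lt_or_ge (j + 1) a with h | h
    · rw [← e1 j h]; exact h1 j h
    · obtain ⟨i, rfl⟩ : ∃ i, j = a + i := ⟨j - a, by omega⟩
      rw [← e2]; exact h2 i (by omega)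

open Classical in
/-- If nothing is required of the relative position of `a - 1` and `a`, the generating function
factors: such words are the shuffles of a word on the small letters and one on the large ones. -/
theorem sum_free_pair {K : Type*} [Field K] (a b : ℕ) (r : ℕ → Prop) (q : K) :
    qPoch q q a * qPoch q q b *
      ∑ w ∈ permWords (a + b) with
        (∀ j, j + 1 < a + b → j + 1 ≠ a → (r j ↔ [j, j + 1].Sublist w)), q ^ revMaj w =
      qPoch q q (a + b) * (patternSum a r q * patternSum b (fun j => r (a + j)) q) := by
  set S := (permWords (a + b)).filter fun w =>
    ∀ j, j + 1 < a + b → j + 1 ≠ a → (r j ↔ [j, j + 1].Sublist w) with hS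
  set T := ((permWords a).filter (HasPattern a r)) ×ˢ
    ((permWords b).filter (HasPattern b fun j => r (a + j))) with hT
  have hST : ∀ w, w ∈ S ↔ splitWord a w ∈ T := by
    intro w
    rw [hS, hT, Finset.mem_filter, Finset.mem_product, Finset.mem_filter, Finset.mem_filter,
      mem_permWords_add_iff, hasPattern_splitWord]
    tauto
  rw [← Finset.sum_fiberwise_of_maps_to (t := T) (g := splitWord a) fun w hw => (hST w).1 hw,
    patternSum, patternSum, Finset.sum_mul_sum, ← Finset.sum_product', Finset.mul_sum,
    Finset.mul_sum]
  refine Finset.sum_congr rfl fun ⟨u, v⟩ huv => ?_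
  have hu : u.Perm (List.range a) := by
    simp only [Finset.mem_product, Finset.mem_filter, mem_permWords] at huv
    exact huv.1.1
  have hv : v.Perm (List.range b) := by
    simp only [Finset.mem_product, Finset.mem_filter, mem_permWords] at huv
    exact huv.2.1
  have hua : ∀ x ∈ u, x < a := fun x hx => List.mem_range.1 (hu.mem_iff.1 hx)
  have hfib : S.filter (fun w => splitWord a w = (u, v)) = shuffles u (v.map (a + ·)) := by
    ext w
    rw [Finset.mem_filter, ← splitWord_eq_iff hua, hST]
    exact ⟨fun h => h.2, fun h => ⟨h ▸ huv, h⟩⟩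
  have key := sum_revMaj_shuffles q u (v.map (a + ·)) (by
    intro x hx y hy
    have := hua x hx
    simp only [List.mem_map] at hy
    obtain ⟨z, -, rfl⟩ := hy
    omega)
  rw [hfib, ← pow_add]
  simpa [hu.length_eq, hv.length_eq, revMaj_map_add] using key

/-! ### From permutations to words -/

/-- The inverse of `σ`, as a function on `ℕ` with the value `0` from `n` on. -/
def invPermFun {n : ℕ} (σ : Equiv.Perm (Fin n)) (i : ℕ) : ℕ :=
  if h : i < n then (σ⁻¹ ⟨i, h⟩ : ℕ) else 0

/-- The one-line notation of `σ⁻¹`, listed backwards. -/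
def invWord {n : ℕ} (σ : Equiv.Perm (Fin n)) : List ℕ :=
  ((List.range n).map (invPermFun σ)).reverse

theorem invPermFun_eq_iff {n : ℕ} (σ : Equiv.Perm (Fin n)) {x y : ℕ} (hx : x < n) (hy : y < n) :
    invPermFun σ x = y ↔ x = σ ⟨y, hy⟩ := by
  rw [invPermFun, dif_pos hx]
  constructor
  · rintro rfl; simp
  · rintro h
    have : (⟨x, hx⟩ : Fin n) = σ ⟨y, hy⟩ := Fin.ext h
    rw [this]; simp

theorem invWord_mem_permWords {n : ℕ} (σ : Equiv.Perm (Fin n)) : invWord σ ∈ permWords n := by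
  rw [mem_permWords, invWord]
  refine (List.reverse_perm _).trans ?_
  have hnd : ((List.range n).map (invPermFun σ)).Nodup := by
    refine (List.nodup_range).map_on fun x hx y hy h => ?_
    rw [List.mem_range] at hx hy
    have hz : invPermFun σ y < n := by rw [invPermFun, dif_pos hy]; exact Fin.is_lt _
    rw [(invPermFun_eq_iff σ hx hz).1 h, ← (invPermFun_eq_iff σ hy hz).1 rfl]
  refine (List.perm_ext_iff_of_nodup hnd List.nodup_range).2 fun y => ?_
  simp only [List.mem_map, List.mem_range]
  constructor
  · rintro ⟨x, hx, rfl⟩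
    rw [invPermFun, dif_pos hx]; exact Fin.is_lt _
  · intro hy
    exact ⟨σ ⟨y, hy⟩, Fin.is_lt _, (invPermFun_eq_iff σ (Fin.is_lt _) hy).2 rfl⟩

theorem invWord_injective (n : ℕ) : Function.Injective (invWord (n := n)) := by
  intro σ τ h
  have h1 : ∀ x, x < n → invPermFun σ x = invPermFun τ x := by
    have := List.reverse_injective h
    rw [List.map_inj_left] at this
    exact fun x hx => this x (List.mem_range.2 hx)
  apply inv_injective
  ext ⟨x, hx⟩
  have := h1 x hx
  rwa [invPermFun, invPermFun, dif_pos hx, dif_pos hx] at this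

theorem image_invWord (n : ℕ) : Finset.univ.image (invWord (n := n)) = permWords n := by
  refine Finset.eq_of_subset_of_card_le ?_ ?_
  · intro w hw
    obtain ⟨σ, -, rfl⟩ := Finset.mem_image.1 hw
    exact invWord_mem_permWords σ
  · rw [Finset.card_image_of_injective _ (invWord_injective n), Finset.card_univ,
      Fintype.card_perm, Fintype.card_fin]
    refine (List.toFinset_card_le _).trans ?_
    simp [List.length_permutations]

/-- `revMaj` of a reversed word is the sum of the descents of the word. -/
theorem revMaj_reverse_map_range (g : ℕ → ℕ) (n : ℕ) :
    revMaj ((List.range n).map g).reverse =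
      ∑ i ∈ Finset.range n with 1 ≤ i ∧ g i < g (i - 1), i := by
  induction n with
  | zero => simp [revMaj]
  | succ n ih =>
    rw [List.range_succ, List.map_append, List.reverse_append, Finset.range_add_one,
      Finset.filter_insert]
    rcases n with _ | n
    · simp [revMaj]
    · rw [List.range_succ, List.map_append, List.reverse_append] at ih ⊢
      simp only [List.map_cons, List.map_nil, List.reverse_cons, List.reverse_nil, List.nil_append,
        List.cons_append] at ih ⊢
      rw [revMaj, ih]
      by_cases h : g (n + 1) < g n
      · rw [if_pos h, if_pos ⟨by omega, by simpa using h⟩, Finset.sum_insert (by simp)]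
        simp; ring
      · rw [if_neg h, if_neg (by simpa using h)]; rfl

theorem revMaj_invWord {n : ℕ} (σ : Equiv.Perm (Fin n)) : revMaj (invWord σ) = permMaj σ⁻¹ := by
  rw [invWord, revMaj_reverse_map_range, permMaj, permDescents]
  refine Finset.sum_congr (Finset.filter_congr fun i hi => ?_) fun _ _ => rfl
  rw [Finset.mem_range] at hi
  rw [invPermFun, invPermFun, dif_pos hi, dif_pos (by omega)]
  constructor
  · rintro ⟨h1, h2⟩; exact ⟨h1, hi, h2⟩
  · rintro ⟨h1, _, h2⟩; exact ⟨h1, h2⟩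

theorem pair_sublist_range_iff {x y n : ℕ} : [x, y].Sublist (List.range n) ↔ x < y ∧ y < n := by
  constructor
  · intro h
    refine ⟨?_, List.mem_range.1 (h.subset (by simp))⟩
    have := List.pairwise_lt_range.sublist h
    simpa using this
  · rintro ⟨h1, h2⟩
    refine List.Sublist.trans ?_ (List.range_sublist.2 (show y + 1 ≤ n from h2))
    rw [List.range_succ]
    exact List.Sublist.append (l₁ := [x]) (by simpa using h1) (List.Sublist.refl [y])

theorem succ_mem_permDescents {n : ℕ} (σ : Equiv.Perm (Fin n)) {j : ℕ} (hj : j + 1 < n) :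
    j + 1 ∈ permDescents σ ↔ σ ⟨j + 1, hj⟩ < σ ⟨j, by omega⟩ := by
  simp [permDescents, hj]

/-- The descents of `σ` are the pairs of consecutive letters that occur in `σ⁻¹` in the wrong
order. -/
theorem pair_sublist_invWord {n : ℕ} (σ : Equiv.Perm (Fin n)) {j : ℕ} (hj : j + 1 < n) :
    [j, j + 1].Sublist (invWord σ) ↔ j + 1 ∈ permDescents σ := by
  rw [succ_mem_permDescents σ hj, invWord, List.sublist_reverse_iff, List.sublist_map_iff]
  constructor
  · rintro ⟨l, hl, h⟩
    obtain ⟨x, y, rfl⟩ : ∃ x y, l = [x, y] := by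
      have := congrArg List.length h
      simp only [List.length_reverse, List.length_map, List.length_cons, List.length_nil] at this
      exact List.length_eq_two.1 this.symm
    obtain ⟨hxy, hy⟩ := pair_sublist_range_iff.1 hl
    simp only [List.reverse_cons, List.reverse_nil, List.nil_append, List.cons_append,
      List.map_cons, List.map_nil, List.cons.injEq, and_true] at h
    have h1 := (invPermFun_eq_iff σ (by omega) hj).1 h.1.symm
    have h2 := (invPermFun_eq_iff σ hy (by omega)).1 h.2.symm
    rw [Fin.lt_def, ← h1, ← h2]; exact hxy
  · intro h
    refine ⟨[σ ⟨j + 1, hj⟩, σ ⟨j, by omega⟩], pair_sublist_range_iff.2 ⟨h, Fin.is_lt _⟩, ?_⟩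
    simp [(invPermFun_eq_iff σ (Fin.is_lt _) hj).2 rfl,
      (invPermFun_eq_iff σ (Fin.is_lt _) (show j < n by omega)).2 rfl]

open Classical in
theorem patternSum_eq_sum_perm {K : Type*} [Field K] (m : ℕ) (r : ℕ → Prop) (q : K) :
    patternSum m r q = ∑ σ : Equiv.Perm (Fin m) with
      (∀ j, j + 1 < m → (r j ↔ j + 1 ∈ permDescents σ)), q ^ permMaj σ⁻¹ := by
  rw [patternSum, ← image_invWord, Finset.filter_image,
    Finset.sum_image ((invWord_injective m).injOn)]
  refine Finset.sum_congr (Finset.filter_congr fun σ _ => ?_) fun σ _ => by rw [revMaj_invWord]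
  exact forall₂_congr fun j hj => by rw [pair_sublist_invWord σ hj]

theorem mem_permDescents_bounds {n : ℕ} {σ : Equiv.Perm (Fin n)} {i : ℕ}
    (hi : i ∈ permDescents σ) : 1 ≤ i ∧ i < n := by
  simp only [permDescents, Finset.mem_filter] at hi
  obtain ⟨_, h1, h2, _⟩ := hi
  exact ⟨h1, h2⟩

theorem permDescents_eq_iff {n : ℕ} (σ : Equiv.Perm (Fin n)) {S : Finset ℕ}
    (hS : ∀ i ∈ S, 1 ≤ i ∧ i < n) :
    permDescents σ = S ↔ ∀ j, j + 1 < n → (j + 1 ∈ S ↔ j + 1 ∈ permDescents σ) := by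
  constructor
  · rintro rfl j _; rfl
  · intro h
    ext i
    constructor <;> intro hi
    · obtain ⟨h1, h2⟩ := mem_permDescents_bounds hi
      obtain ⟨j, rfl⟩ := Nat.exists_eq_add_of_le' h1
      exact (h j h2).2 hi
    · obtain ⟨h1, h2⟩ := hS i hi
      obtain ⟨j, rfl⟩ := Nat.exists_eq_add_of_le' h1
      exact (h j h2).1 hi

theorem qEuler_eq_patternSum {K : Type*} [Field K] (n : ℕ) (q : K) :
    qEuler n q = patternSum n Odd q := by
  classical
  rw [patternSum_eq_sum_perm, qEuler]
  refine Finset.sum_congr (Finset.filter_congr fun σ _ => ?_) fun _ _ => rfl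
  rw [IsRevAltPerm, permDescents_eq_iff]
  · refine forall₂_congr fun j hj => iff_congr ?_ Iff.rfl
    simp only [Finset.mem_image, Finset.mem_range, Nat.odd_iff]
    constructor
    · rintro ⟨k, _, hk⟩; omega
    · intro h; exact ⟨j / 2, by omega, by omega⟩
  · intro i hi
    simp only [Finset.mem_image, Finset.mem_range] at hi
    obtain ⟨k, _, hk⟩ := hi; omega

theorem qEulerStar_eq_patternSum {K : Type*} [Field K] (n : ℕ) (q : K) :
    qEulerStar n q = patternSum n Even q := by
  classical
  rw [patternSum_eq_sum_perm, qEulerStar]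
  refine Finset.sum_congr (Finset.filter_congr fun σ _ => ?_) fun _ _ => rfl
  rw [IsAltPerm, permDescents_eq_iff]
  · refine forall₂_congr fun j hj => iff_congr ?_ Iff.rfl
    simp only [Finset.mem_image, Finset.mem_range, Nat.even_iff]
    constructor
    · rintro ⟨k, _, hk⟩; omega
    · intro h; exact ⟨j / 2, by omega, by omega⟩
  · intro i hi
    simp only [Finset.mem_image, Finset.mem_range] at hi
    obtain ⟨k, _, hk⟩ := hi; omega

theorem permMaj_eq_sum_of_descents {n : ℕ} {σ : Equiv.Perm (Fin n)} (h : StrictAnti σ) :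
    permMaj σ = ∑ i ∈ Finset.range n, i := by
  rw [permMaj]
  refine Finset.sum_subset (Finset.filter_subset _ _) fun i hi hi' => ?_
  by_contra h0
  obtain ⟨j, rfl⟩ := Nat.exists_eq_add_of_le' (Nat.one_le_iff_ne_zero.2 h0)
  exact hi' ((succ_mem_permDescents σ (Finset.mem_range.1 hi)).2 (h (by simp)))

/-- The only word without inverse descents is the identity. -/
theorem patternSum_false {K : Type*} [Field K] (m : ℕ) (q : K) :
    patternSum m (fun _ => False) q = 1 := by
  classical
  rw [patternSum_eq_sum_perm, Finset.sum_eq_single_of_mem 1]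
  · have : permDescents (1 : Equiv.Perm (Fin m)) = ∅ := by
      refine (permDescents_eq_iff _ (by simp)).2 fun j hj => ?_
      simp [succ_mem_permDescents _ hj]
    simp [permMaj, this]
  · rw [Finset.mem_filter]
    refine ⟨Finset.mem_univ _, fun j hj => ?_⟩
    simp [succ_mem_permDescents _ hj]
  · intro σ hσ h1
    refine absurd ?_ h1
    have hmono : StrictMono σ := by
      rcases m with _ | m
      · exact fun a => a.elim0
      rw [Fin.strictMono_iff_lt_succ]
      intro i
      have h2 := ((Finset.mem_filter.1 hσ).2 i (by simp)).not.1 not_false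
      rw [succ_mem_permDescents σ (by simp), not_lt] at h2
      refine lt_of_le_of_ne h2 fun h3 => ?_
      have := congrArg Fin.val (σ.injective h3)
      simp at this
    have := Subsingleton.elim (hmono.orderIsoOfSurjective σ σ.surjective) (OrderIso.refl _)
    ext i
    exact congrArg Fin.val (DFunLike.congr_fun this i)

/-- The only word with all inverse descents is the decreasing one. -/
theorem patternSum_true {K : Type*} [Field K] (m : ℕ) (q : K) :
    patternSum m (fun _ => True) q = q ^ (m.choose 2) := by
  classical
  have hanti : StrictAnti (Fin.revPerm : Equiv.Perm (Fin m)) := fun a b h => Fin.rev_lt_rev.2 h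
  rw [patternSum_eq_sum_perm, Finset.sum_eq_single_of_mem Fin.revPerm]
  · have h1 : (Fin.revPerm : Equiv.Perm (Fin m))⁻¹ = Fin.revPerm := Fin.revPerm_symm
    rw [h1, permMaj_eq_sum_of_descents hanti, Finset.sum_range_id, Nat.choose_two_right]
  · rw [Finset.mem_filter]
    refine ⟨Finset.mem_univ _, fun j hj => ?_⟩
    rw [succ_mem_permDescents _ hj, true_iff]
    exact hanti (by simp)
  · intro σ hσ h1
    refine absurd ?_ h1
    have hmono : StrictMono fun i => Fin.rev (σ i) := by
      rcases m with _ | m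
      · exact fun a => a.elim0
      rw [Fin.strictMono_iff_lt_succ]
      intro i
      have h2 := ((Finset.mem_filter.1 hσ).2 i (by simp)).1 trivial
      rw [succ_mem_permDescents σ (by simp)] at h2
      exact Fin.rev_lt_rev.2 h2
    have := Subsingleton.elim (hmono.orderIsoOfSurjective _
      (Fin.rev_surjective.comp σ.surjective)) (OrderIso.refl _)
    ext i
    have h3 : Fin.rev (σ i) = i := DFunLike.congr_fun this i
    rw [← Fin.rev_rev (σ i), h3]; rfl

/-! ### The recurrence for the Euler numbers -/

section

variable {K : Type*} [Field K]

theorem sum_neg_one_pow_mul_add (g : ℕ → K) (n : ℕ) :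
    ∑ k ∈ Finset.range (n + 1), (-1) ^ k * (g k + g (k + 1)) = g 0 + (-1) ^ n * g (n + 1) := by
  induction n with
  | zero => simp
  | succ n ih => rw [Finset.sum_range_succ, ih]; ring

open Classical in
/-- Words whose first `2 * k` letters have constant pattern `c` and whose remaining letters
alternate, nothing being required at the juncture, split according to the order there: either the
alternation extends to the juncture, or the constant block is longer by two. -/
theorem sum_free_pair_eq_add (n k : ℕ) (hk : 1 ≤ k) (hkn : k < n) (c : Prop) (s : ℕ → Prop)
    (hs : ∀ j, s (2 * j) ↔ c) (hs' : ∀ j, s (2 * j + 1) ↔ ¬c) (q : K) :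
    ∑ w ∈ permWords (2 * n) with (∀ j, j + 1 < 2 * n → j + 1 ≠ 2 * k →
        ((if j < 2 * k then c else s j) ↔ [j, j + 1].Sublist w)), q ^ revMaj w =
      patternSum (2 * n) (fun j => if j + 1 < 2 * k then c else s j) q +
      patternSum (2 * n) (fun j => if j + 1 < 2 * (k + 1) then c else s j) q := by
  rw [← Finset.sum_filter_add_sum_filter_not _ fun w => s (2 * k - 1) ↔
    [2 * k - 1, 2 * k].Sublist w, patternSum, patternSum, Finset.filter_filter,
    Finset.filter_filter]
  simp only [HasPattern]
  have hj0 : s (2 * k - 1) ↔ ¬c := by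
    obtain ⟨i, rfl⟩ := Nat.exists_eq_add_of_le' hk
    rw [← hs' i]; rfl
  congr 1
  · refine Finset.sum_congr (Finset.filter_congr fun w _ => ?_) fun _ _ => rfl
    constructor
    · rintro ⟨h1, h2⟩ j hj
      rcases eq_or_ne (j + 1) (2 * k) with h | h
      · obtain rfl : j = 2 * k - 1 := by omega
        rw [if_neg (by omega), h2, h]
      · rw [← h1 j hj h]
        by_cases h3 : j < 2 * k
        · rw [if_pos h3, if_pos (by omega)]
        · rw [if_neg h3, if_neg (by omega)]
    · intro h1
      refine ⟨fun j hj h => ?_, ?_⟩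
      · rw [← h1 j hj]
        by_cases h3 : j < 2 * k
        · rw [if_pos h3, if_pos (by omega)]
        · rw [if_neg h3, if_neg (by omega)]
      · have := h1 (2 * k - 1) (by omega)
        rwa [if_neg (by omega), show 2 * k - 1 + 1 = 2 * k by omega] at this
  · refine Finset.sum_congr (Finset.filter_congr fun w _ => ?_) fun _ _ => rfl
    have e : ∀ j, j + 1 ≠ 2 * k →
        ((if j + 1 < 2 * (k + 1) then c else s j) ↔ (if j < 2 * k then c else s j)) := by
      intro j hj
      rcases lt_trichotomy j (2 * k) with h3 | rfl | h3
      · rw [if_pos h3, if_pos (by omega)]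
      · rw [if_pos (by omega), if_neg (by omega), hs]
      · rw [if_neg (by omega), if_neg (by omega)]
    constructor
    · rintro ⟨h1, h2⟩ j hj
      rcases eq_or_ne (j + 1) (2 * k) with h | h
      · obtain rfl : j = 2 * k - 1 := by omega
        rw [if_pos (by omega), h]
        rw [hj0] at h2
        tauto
      · rw [← h1 j hj h, e j h]
    · intro h1
      refine ⟨fun j hj h => ?_, ?_⟩
      · rw [← h1 j hj, e j h]
      · have := h1 (2 * k - 1) (by omega)
        rw [if_pos (by omega), show 2 * k - 1 + 1 = 2 * k by omega] at this
        rw [hj0]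
        tauto

theorem patternSum_congr {m : ℕ} {r r' : ℕ → Prop} (h : ∀ j, j + 1 < m → (r j ↔ r' j)) (q : K) :
    patternSum m r q = patternSum m r' q := by
  classical
  refine Finset.sum_congr (Finset.filter_congr fun w _ => ?_) fun _ _ => rfl
  exact forall₂_congr fun j hj => by rw [h j hj]

theorem qPoch_ne_zero {q : K} {N m : ℕ} (hq : ∀ k : ℕ, 1 ≤ k → k ≤ N → q ^ k ≠ 1) (hm : m ≤ N) :
    qPoch q q m ≠ 0 := by
  rw [qPoch, Finset.prod_ne_zero_iff]
  intro i hi h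
  rw [Finset.mem_range] at hi
  rw [← pow_succ'] at h
  exact hq (i + 1) (by omega) (by omega) (sub_eq_zero.1 h).symm

/-- The series with coefficients `patternSum (2 * n) s q / (q; q)_{2n}`, for an alternating
pattern `s`, is the inverse of the alternating series over the constant patterns `s 0`. -/
theorem sum_range_patternSum (n : ℕ) (hn : 1 ≤ n) (s : ℕ → Prop)
    (hs : ∀ j, s (2 * j) ↔ s 0) (hs' : ∀ j, s (2 * j + 1) ↔ ¬s 0) (q : K)
    (hq : ∀ k : ℕ, 1 ≤ k → k ≤ 2 * n → q ^ k ≠ 1) :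
    ∑ k ∈ Finset.range (n + 1), (-1) ^ k * (patternSum (2 * k) (fun _ => s 0) q /
        qPoch q q (2 * k)) * (patternSum (2 * (n - k)) s q / qPoch q q (2 * (n - k))) = 0 := by
  classical
  -- Cutting `G` off outside `1, …, n` makes the splitting `G k + G (k + 1)` hold at both ends too.
  set G : ℕ → K := fun k => if 1 ≤ k ∧ k ≤ n then
    patternSum (2 * n) (fun j => if j + 1 < 2 * k then s 0 else s j) q else 0 with hG
  have hH : ∀ k, k ≤ n →
      ∑ w ∈ permWords (2 * n) with (∀ j, j + 1 < 2 * n → j + 1 ≠ 2 * k →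
        ((if j < 2 * k then s 0 else s j) ↔ [j, j + 1].Sublist w)), q ^ revMaj w =
      G k + G (k + 1) := by
    intro k hk
    rcases Nat.eq_zero_or_pos k with rfl | hk0
    · simp only [hG]
      rw [if_neg (by omega), if_pos (by omega), zero_add, patternSum]
      simp only [HasPattern]
      refine Finset.sum_congr (Finset.filter_congr fun w _ => forall₂_congr fun j hj => ?_)
        fun _ _ => rfl
      rcases Nat.eq_zero_or_pos j with rfl | hj0
      · simp
      · rw [if_neg (by omega), if_neg (by omega)]
        simp
    rcases lt_or_eq_of_le hk with hkn | rfl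
    · rw [sum_free_pair_eq_add n k hk0 hkn (s 0) s hs hs' q]
      simp only [hG]
      rw [if_pos (by omega), if_pos (by omega)]
    · simp only [hG]
      rw [if_pos (by omega), if_neg (by omega), add_zero, patternSum]
      simp only [HasPattern]
      refine Finset.sum_congr (Finset.filter_congr fun w _ => forall₂_congr fun j hj => ?_)
        fun _ _ => rfl
      rw [if_pos (by omega), if_pos hj]
      exact ⟨fun h => h hj.ne, fun h _ => h⟩
  have hterm : ∀ k ∈ Finset.range (n + 1), (-1) ^ k * (patternSum (2 * k) (fun _ => s 0) q /
        qPoch q q (2 * k)) * (patternSum (2 * (n - k)) s q / qPoch q q (2 * (n - k))) =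
      (qPoch q q (2 * n))⁻¹ * ((-1) ^ k * (G k + G (k + 1))) := by
    intro k hk
    have hkn : k ≤ n := by rw [Finset.mem_range] at hk; omega
    have h0 := qPoch_ne_zero hq (le_refl (2 * n))
    have h1 := qPoch_ne_zero hq (show 2 * k ≤ 2 * n by omega)
    have h2 := qPoch_ne_zero hq (show 2 * (n - k) ≤ 2 * n by omega)
    have key := sum_free_pair (2 * k) (2 * (n - k)) (fun j => if j < 2 * k then s 0 else s j) q
    rw [show 2 * k + 2 * (n - k) = 2 * n by omega, hH k hkn,
      patternSum_congr (r' := fun _ => s 0) (fun j hj => by rw [if_pos (by omega)]),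
      patternSum_congr (m := 2 * (n - k)) (r' := s) (fun j hj => by
        rw [if_neg (by omega)]
        obtain ⟨i, rfl | rfl⟩ := Nat.even_or_odd' j
        · rw [← mul_add, hs, hs]
        · rw [← add_assoc, ← mul_add, hs', hs'])] at key
    field_simp
    linear_combination -key
  rw [Finset.sum_congr rfl hterm, ← Finset.mul_sum, sum_neg_one_pow_mul_add]
  simp [hG]

end

/-! ### Weighted sums over lattice paths -/

/-- The paths with `m` unit up or down steps from height `h` to height `0` that never go below
height `0`. -/
def pathsToZero : ℕ → ℕ → Finset (List DyckStep)
  | 0, 0 => {[]}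
  | 0, _ + 1 => ∅
  | m + 1, 0 => (pathsToZero m 1).image (List.cons DyckStep.U)
  | m + 1, h + 1 => (pathsToZero m (h + 2)).image (List.cons DyckStep.U) ∪
      (pathsToZero m h).image (List.cons DyckStep.D)

/-- The height after the first `i` steps of a path that starts at height `h`. -/
def heightFrom (h : ℕ) (l : List DyckStep) (i : ℕ) : ℕ :=
  h + (l.take i).count DyckStep.U - (l.take i).count DyckStep.D

theorem heightFrom_zero (h : ℕ) (l : List DyckStep) : heightFrom h l 0 = h := by simp [heightFrom]

theorem heightFrom_cons_U (h : ℕ) (l : List DyckStep) (i : ℕ) :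
    heightFrom h (DyckStep.U :: l) (i + 1) = heightFrom (h + 1) l i := by
  simp [heightFrom]; omega

theorem heightFrom_cons_D (h : ℕ) (l : List DyckStep) (i : ℕ) :
    heightFrom (h + 1) (DyckStep.D :: l) (i + 1) = heightFrom h l i := by
  simp [heightFrom]; omega

theorem mem_pathsToZero {m h : ℕ} {l : List DyckStep} :
    l ∈ pathsToZero m h ↔ l.length = m ∧ l.count DyckStep.D = h + l.count DyckStep.U ∧
      ∀ i, (l.take i).count DyckStep.D ≤ h + (l.take i).count DyckStep.U := by
  have cons_forall : ∀ (s : DyckStep) (l : List DyckStep) (h : ℕ),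
      (∀ i, ((s :: l).take i).count DyckStep.D ≤ h + ((s :: l).take i).count DyckStep.U) ↔
      ∀ i, (s :: l.take i).count DyckStep.D ≤ h + (s :: l.take i).count DyckStep.U := by
    intro s l h
    refine ⟨fun H i => by simpa using H (i + 1), fun H i => ?_⟩
    rcases i with _ | i
    · simp
    · simpa using H i
  induction m generalizing h l with
  | zero =>
    rcases h with _ | h
    · simp only [pathsToZero, Finset.mem_singleton, List.length_eq_zero_iff]
      exact ⟨by rintro rfl; simp, fun H => H.1⟩
    · simp only [pathsToZero, Finset.notMem_empty, List.length_eq_zero_iff, false_iff]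
      rintro ⟨rfl, h1, -⟩
      simp at h1
  | succ m ih =>
    rcases l with _ | ⟨s, l⟩
    · rcases h with _ | h <;> simp [pathsToZero]
    · rw [cons_forall]
      rcases h with _ | h <;> rcases s with _ | _ <;>
        simp [pathsToZero, ih]
      · intro _
        exact and_congr (by omega) (forall_congr' fun i => by omega)
      · intro _ _
        exact ⟨0, by simp⟩
      · intro _
        exact and_congr (by omega) (forall_congr' fun i => by omega)
      · intro _
        exact and_congr (by omega) (forall_congr' fun i => by omega)

section

variable {K : Type*} [Field K]

/-- The sum over all paths with `m` steps from height `h` to `0` of the product of the weights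
`W i h'` of the points visited after the start, where `i` is the abscissa, `h'` is the height, and
the starting point has abscissa `i₀`. -/
def pathSum (W : ℕ → ℕ → K) (m i₀ h : ℕ) : K :=
  ∑ l ∈ pathsToZero m h, ∏ k ∈ Finset.range m, W (i₀ + k + 1) (heightFrom h l (k + 1))

theorem pathSum_zero_zero (W : ℕ → ℕ → K) (i : ℕ) : pathSum W 0 i 0 = 1 := by
  simp [pathSum, pathsToZero]

theorem pathSum_zero_succ (W : ℕ → ℕ → K) (i h : ℕ) : pathSum W 0 i (h + 1) = 0 := by
  simp [pathSum, pathsToZero]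

theorem sum_image_cons_U (W : ℕ → ℕ → K) (m i h : ℕ) :
    ∑ l ∈ (pathsToZero m (h + 1)).image (List.cons DyckStep.U),
      ∏ k ∈ Finset.range (m + 1), W (i + k + 1) (heightFrom h l (k + 1)) =
    W (i + 1) (h + 1) * pathSum W m (i + 1) (h + 1) := by
  rw [Finset.sum_image fun x _ y _ hxy => (List.cons.inj hxy).2, pathSum, Finset.mul_sum]
  refine Finset.sum_congr rfl fun l _ => ?_
  rw [Finset.prod_range_succ', mul_comm]
  simp only [heightFrom_cons_U, heightFrom_zero, add_zero]
  congr 1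
  exact Finset.prod_congr rfl fun k _ => by rw [show i + (k + 1) + 1 = i + 1 + k + 1 by ring]

theorem sum_image_cons_D (W : ℕ → ℕ → K) (m i h : ℕ) :
    ∑ l ∈ (pathsToZero m h).image (List.cons DyckStep.D),
      ∏ k ∈ Finset.range (m + 1), W (i + k + 1) (heightFrom (h + 1) l (k + 1)) =
    W (i + 1) h * pathSum W m (i + 1) h := by
  rw [Finset.sum_image fun x _ y _ hxy => (List.cons.inj hxy).2, pathSum, Finset.mul_sum]
  refine Finset.sum_congr rfl fun l _ => ?_
  rw [Finset.prod_range_succ', mul_comm]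
  simp only [heightFrom_cons_D, heightFrom_zero, add_zero]
  congr 1
  exact Finset.prod_congr rfl fun k _ => by rw [show i + (k + 1) + 1 = i + 1 + k + 1 by ring]

/-- From height `0` only an up step is possible. -/
theorem pathSum_succ_zero (W : ℕ → ℕ → K) (m i : ℕ) :
    pathSum W (m + 1) i 0 = W (i + 1) 1 * pathSum W m (i + 1) 1 := by
  rw [pathSum, pathsToZero, sum_image_cons_U]

theorem pathSum_succ_succ (W : ℕ → ℕ → K) (m i h : ℕ) :
    pathSum W (m + 1) i (h + 1) = W (i + 1) (h + 2) * pathSum W m (i + 1) (h + 2) +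
      W (i + 1) h * pathSum W m (i + 1) h := by
  rw [pathSum, pathsToZero, Finset.sum_union, sum_image_cons_U, sum_image_cons_D]
  rw [Finset.disjoint_left]
  intro w h1 h2
  obtain ⟨x, -, rfl⟩ := Finset.mem_image.1 h1
  obtain ⟨y, -, h⟩ := Finset.mem_image.1 h2
  simp at h

theorem pathSum_eq_zero_of_lt (W : ℕ → ℕ → K) {m h : ℕ} (i : ℕ) (hm : m < h) :
    pathSum W m i h = 0 := by
  induction m generalizing i h with
  | zero =>
    obtain ⟨h, rfl⟩ := Nat.exists_eq_add_of_le' hm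
    exact pathSum_zero_succ W i h
  | succ m ih =>
    obtain ⟨h, rfl⟩ := Nat.exists_eq_add_of_le' (show 1 ≤ h by omega)
    rw [pathSum_succ_succ, ih _ (by omega), ih _ (by omega), mul_zero, mul_zero, add_zero]

/-- A path that starts below the diagonal stays below it. -/
theorem pathSum_eq_of_lt {W : ℕ → ℕ → K} {w : ℕ → K} (hW : ∀ i h, h < i → W i h = w h)
    {m i h : ℕ} (hi : h < i) : pathSum W m i h = pathSum (fun _ => w) m 0 h := by
  have shift : ∀ m i h, pathSum (fun _ => w) m i h = pathSum (fun _ => w) m 0 h := fun _ _ _ => rfl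
  induction m generalizing i h with
  | zero => rcases h with _ | h <;> simp [pathSum, pathsToZero]
  | succ m ih =>
    rcases h with _ | h
    · rw [pathSum_succ_zero, pathSum_succ_zero, ih (by omega), hW _ _ (by omega), shift _ 1]
    · rw [pathSum_succ_succ, pathSum_succ_succ, ih (by omega), ih (by omega), hW _ _ (by omega),
        hW _ _ (by omega)]
      rfl

theorem sum_dyckWord_eq_pathSum (W : ℕ → ℕ → K) (n : ℕ) :
    ∑ d : {d : DyckWord // d.semilength = n}, ∏ i ∈ Finset.Icc 1 (2 * n), W i (dyckHeight d.1 i) =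
      pathSum W (2 * n) 0 0 := by
  refine Finset.sum_bij (fun d _ => d.1.toList) ?_ ?_ ?_ ?_
  · rintro ⟨d, rfl⟩ -
    rw [mem_pathsToZero]
    exact ⟨d.two_mul_semilength_eq_length.symm, by rw [zero_add, d.count_U_eq_count_D],
      fun i => by rw [zero_add]; exact d.count_D_le_count_U i⟩
  · intro d _ e _ h
    exact Subtype.ext (DyckWord.ext h)
  · intro l hl
    obtain ⟨h1, h2, h3⟩ := mem_pathsToZero.1 hl
    rw [zero_add] at h2
    refine ⟨⟨⟨l, h2.symm, fun i => by simpa using h3 i⟩, ?_⟩, Finset.mem_univ _, rfl⟩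
    have := DyckWord.two_mul_semilength_eq_length (p := ⟨l, h2.symm, fun i => by simpa using h3 i⟩)
    simp only [h1] at this
    omega
  · intro d _
    simp only [zero_add]
    rw [Finset.range_eq_Ico,
      Finset.prod_Ico_add' (fun k => W k (heightFrom 0 d.1.toList k)) 0 (2 * n) 1,
      show Finset.Icc 1 (2 * n) = Finset.Ico (0 + 1) (2 * n + 1) by ext; simp]
    refine Finset.prod_congr rfl fun i _ => ?_
    rw [heightFrom, dyckHeight, zero_add]

/-! ### Solving the path recursions -/

open Finset in
theorem signed_conv_succ (C f : ℕ → K) (k : ℕ) :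
    ∑ x ∈ antidiagonal (k + 1), (-1) ^ x.1 * C x.1 * f x.2 =
      (-1) ^ (k + 1) * C (k + 1) * f 0 +
        ∑ x ∈ antidiagonal k, (-1) ^ x.1 * C x.1 * f (x.2 + 1) := by
  rw [Finset.Nat.sum_antidiagonal_succ', add_comm]

open Finset in
/-- Let `p h j` be the sum over paths from height `h` to `0` with `j` up steps, weighted by `w` at
every point including the start. If `d` satisfies the relations that the recursion for `p` imposes,
then `(∑ (-1)^k C k x^k) (∑ p h j x^j) = ∑ (-1)^k d h k x^k`. The coefficient at `(h, k)` involves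
only relations below it, so that they are required only up to a bound `N`. -/
theorem signed_conv_pathSum {w C : ℕ → K} {d : ℕ → ℕ → K} {N : ℕ} (hC : C 0 = 1)
    (h00 : 1 ≤ N → d 0 0 = w 0)
    (hh0 : ∀ h, 2 * h + 3 ≤ N → d (h + 1) 0 = w (h + 1) * d h 0)
    (h0k : ∀ k, 2 * k + 3 ≤ N → d 0 (k + 1) = w 0 * (C (k + 1) - d 1 k))
    (hhk : ∀ h k, 2 * h + 2 * k + 5 ≤ N →
      d (h + 1) (k + 1) = w (h + 1) * (d h (k + 1) - d (h + 2) k))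
    (k h : ℕ) (hN : 2 * h + 2 * k + 1 ≤ N) :
    ∑ x ∈ antidiagonal k, (-1) ^ x.1 * C x.1 *
      (w h * pathSum (fun _ => w) (h + 2 * x.2) 0 h) = (-1) ^ k * d h k := by
  have shift : ∀ m i h, pathSum (fun _ => w) m i h = pathSum (fun _ => w) m 0 h := fun _ _ _ => rfl
  have r0 : ∀ j, pathSum (fun _ => w) (0 + 2 * (j + 1)) 0 0 =
      w 1 * pathSum (fun _ => w) (1 + 2 * j) 0 1 := by
    intro j
    rw [show 0 + 2 * (j + 1) = (1 + 2 * j) + 1 by ring, pathSum_succ_zero, shift]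
  have r10 : ∀ h, pathSum (fun _ => w) (h + 1 + 2 * 0) 0 (h + 1) =
      w h * pathSum (fun _ => w) (h + 2 * 0) 0 h := by
    intro h
    rw [show h + 1 + 2 * 0 = h + 1 by ring, pathSum_succ_succ,
      pathSum_eq_zero_of_lt _ _ (by omega), mul_zero, zero_add, shift]
    rfl
  have r1 : ∀ h j, pathSum (fun _ => w) (h + 1 + 2 * (j + 1)) 0 (h + 1) =
      w (h + 2) * pathSum (fun _ => w) (h + 2 + 2 * j) 0 (h + 2) +
        w h * pathSum (fun _ => w) (h + 2 * (j + 1)) 0 h := by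
    intro h j
    rw [show h + 1 + 2 * (j + 1) = (h + 2 + 2 * j) + 1 by ring, pathSum_succ_succ, shift,
      shift _ _ h, show h + 2 + 2 * j = h + 2 * (j + 1) by ring]
  induction k generalizing h with
  | zero =>
    simp only [Nat.antidiagonal_zero, sum_singleton, pow_zero, one_mul, hC]
    induction h with
    | zero => rw [h00 (by omega)]; simp [pathSum_zero_zero]
    | succ h ihh => rw [r10, ihh (by omega), hh0 h (by omega)]
  | succ k ih =>
    induction h with
    | zero =>
      have := ih 1 (by omega)
      rw [signed_conv_succ C fun j => w 0 * pathSum (fun _ => w) (0 + 2 * j) 0 0]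
      simp only [r0]
      rw [h0k k (by omega), show 0 + 2 * 0 = 0 from rfl, pathSum_zero_zero]
      calc _ = (-1) ^ (k + 1) * C (k + 1) * w 0 + w 0 * ∑ x ∈ antidiagonal k,
            (-1) ^ x.1 * C x.1 * (w 1 * pathSum (fun _ => w) (1 + 2 * x.2) 0 1) := by
              rw [mul_sum, mul_one]
              congr 1
              exact sum_congr rfl fun x _ => by ring
        _ = _ := by rw [this]; ring
    | succ h ihh =>
      have e1 := ih (h + 2) (by omega)
      have e2 := ihh (by omega)
      rw [signed_conv_succ C fun j => w h * pathSum (fun _ => w) (h + 2 * j) 0 h] at e2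
      rw [signed_conv_succ C fun j => w (h + 1) * pathSum (fun _ => w) (h + 1 + 2 * j) 0 (h + 1)]
      simp only [r1, r10]
      rw [hhk h k (by omega)]
      calc _ = w (h + 1) * (((-1) ^ (k + 1) * C (k + 1) *
              (w h * pathSum (fun _ => w) (h + 2 * 0) 0 h) + ∑ x ∈ antidiagonal k,
                (-1) ^ x.1 * C x.1 * (w h * pathSum (fun _ => w) (h + 2 * (x.2 + 1)) 0 h)) +
            ∑ x ∈ antidiagonal k, (-1) ^ x.1 * C x.1 *
              (w (h + 2) * pathSum (fun _ => w) (h + 2 + 2 * x.2) 0 (h + 2))) := by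
              rw [add_assoc, ← sum_add_distrib, mul_add, mul_sum]
              congr 1
              · ring
              · exact sum_congr rfl fun x _ => by ring
        _ = _ := by rw [e1, e2]; ring

open Finset in
/-- The analogue of `signed_conv_pathSum` for paths that start on the diagonal, where abscissa and
height agree: points have weight `v` on the diagonal and weight `w` below it. -/
theorem signed_conv_pathSum_diagonal {W : ℕ → ℕ → K} {w v C : ℕ → K} {d g : ℕ → ℕ → K} {N : ℕ}
    (hW : ∀ i h, h < i → W i h = w h) (hWd : ∀ h, W (h + 1) (h + 1) = v (h + 1)) (hC : C 0 = 1)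
    (hd : ∀ k h, 2 * h + 2 * k + 1 ≤ N → ∑ x ∈ antidiagonal k, (-1) ^ x.1 * C x.1 *
      (w h * pathSum (fun _ => w) (h + 2 * x.2) 0 h) = (-1) ^ k * d h k)
    (hg0 : ∀ h, 2 * h + 2 ≤ N → g (h + 1) 0 = v (h + 1) * d h 0)
    (hgk : ∀ h k, 2 * h + 2 * k + 4 ≤ N →
      g (h + 1) (k + 1) = v (h + 1) * (d h (k + 1) - g (h + 2) k))
    (k h : ℕ) (hN : 2 * h + 2 * k + 2 ≤ N) :
    ∑ x ∈ antidiagonal k, (-1) ^ x.1 * C x.1 *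
      (v (h + 1) * pathSum W (h + 1 + 2 * x.2) (h + 1) (h + 1)) = (-1) ^ k * g (h + 1) k := by
  have r0 : ∀ h, pathSum W (h + 1 + 2 * 0) (h + 1) (h + 1) =
      w h * pathSum (fun _ => w) (h + 2 * 0) 0 h := by
    intro h
    rw [show h + 1 + 2 * 0 = h + 1 by ring, pathSum_succ_succ,
      pathSum_eq_zero_of_lt _ _ (by omega), mul_zero, zero_add, hW _ _ (by omega),
      pathSum_eq_of_lt hW (by omega)]
    rfl
  have r1 : ∀ h j, pathSum W (h + 1 + 2 * (j + 1)) (h + 1) (h + 1) =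
      v (h + 2) * pathSum W (h + 2 + 2 * j) (h + 2) (h + 2) +
        w h * pathSum (fun _ => w) (h + 2 * (j + 1)) 0 h := by
    intro h j
    rw [show h + 1 + 2 * (j + 1) = (h + 2 + 2 * j) + 1 by ring, pathSum_succ_succ, hWd,
      hW _ h (by omega), pathSum_eq_of_lt (h := h) hW (by omega),
      show h + 2 + 2 * j = h + 2 * (j + 1) by ring]
  induction k generalizing h with
  | zero =>
    have := hd 0 h (by omega)
    simp only [Nat.antidiagonal_zero, sum_singleton, pow_zero, one_mul, hC] at this ⊢
    rw [r0, this, hg0 h (by omega)]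
  | succ k ih =>
    have e1 := ih (h + 1) (by omega)
    have e2 := hd (k + 1) h (by omega)
    rw [signed_conv_succ C fun j => w h * pathSum (fun _ => w) (h + 2 * j) 0 h] at e2
    rw [signed_conv_succ C fun j => v (h + 1) * pathSum W (h + 1 + 2 * j) (h + 1) (h + 1)]
    simp only [r1, r0]
    rw [hgk h k (by omega)]
    calc _ = v (h + 1) * (((-1) ^ (k + 1) * C (k + 1) *
            (w h * pathSum (fun _ => w) (h + 2 * 0) 0 h) + ∑ x ∈ antidiagonal k,
              (-1) ^ x.1 * C x.1 * (w h * pathSum (fun _ => w) (h + 2 * (x.2 + 1)) 0 h)) +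
          ∑ x ∈ antidiagonal k, (-1) ^ x.1 * C x.1 *
            (v (h + 2) * pathSum W (h + 2 + 2 * x.2) (h + 2) (h + 2))) := by
            rw [add_assoc, ← sum_add_distrib, mul_add, mul_sum]
            congr 1
            · ring
            · exact sum_congr rfl fun x _ => by ring
      _ = _ := by rw [e1, e2]; ring

open Finset in
/-- The generating function of Dyck paths with weight `v` on the initial run of up steps and `w`
afterwards is inverse to the alternating generating function of `C`. -/
theorem signed_conv_dyck {W : ℕ → ℕ → K} {w v C : ℕ → K} {d g : ℕ → ℕ → K} {N : ℕ}
    (hW : ∀ i h, h < i → W i h = w h) (hWd : ∀ h, W (h + 1) (h + 1) = v (h + 1)) (hC : C 0 = 1)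
    (h00 : 1 ≤ N → d 0 0 = w 0)
    (hh0 : ∀ h, 2 * h + 3 ≤ N → d (h + 1) 0 = w (h + 1) * d h 0)
    (h0k : ∀ k, 2 * k + 3 ≤ N → d 0 (k + 1) = w 0 * (C (k + 1) - d 1 k))
    (hhk : ∀ h k, 2 * h + 2 * k + 5 ≤ N →
      d (h + 1) (k + 1) = w (h + 1) * (d h (k + 1) - d (h + 2) k))
    (hg0 : ∀ h, 2 * h + 2 ≤ N → g (h + 1) 0 = v (h + 1) * d h 0)
    (hgk : ∀ h k, 2 * h + 2 * k + 4 ≤ N →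
      g (h + 1) (k + 1) = v (h + 1) * (d h (k + 1) - g (h + 2) k))
    (hgC : ∀ k, 2 * k + 2 ≤ N → g 1 k = C (k + 1))
    (k : ℕ) (hN : 2 * k + 2 ≤ N) :
    ∑ x ∈ antidiagonal (k + 1), (-1) ^ x.1 * C x.1 * pathSum W (2 * x.2) 0 0 = 0 := by
  have key := signed_conv_pathSum_diagonal hW hWd hC
    (signed_conv_pathSum hC h00 hh0 h0k hhk) hg0 hgk k 0 (by omega)
  have r : ∀ j, pathSum W (2 * (j + 1)) 0 0 =
      v (0 + 1) * pathSum W (0 + 1 + 2 * j) (0 + 1) (0 + 1) := by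
    intro j
    rw [show 2 * (j + 1) = (0 + 1 + 2 * j) + 1 by ring, pathSum_succ_zero, ← hWd]
  rw [signed_conv_succ C fun j => pathSum W (2 * j) 0 0]
  simp only [r]
  rw [key, mul_zero, pathSum_zero_zero, hgC k hN]
  ring

open Finset in
/-- The inverse of an alternating series with constant term `1` is unique. -/
theorem eq_of_signed_conv {C A B : ℕ → K} {n : ℕ} (hC : C 0 = 1) (h0 : A 0 = B 0)
    (h : ∀ k, k + 1 ≤ n → ∑ x ∈ antidiagonal (k + 1), (-1) ^ x.1 * C x.1 * A x.2 =
      ∑ x ∈ antidiagonal (k + 1), (-1) ^ x.1 * C x.1 * B x.2) (m : ℕ) (hm : m ≤ n) :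
    A m = B m := by
  induction m using Nat.strong_induction_on with
  | _ m ih =>
  rcases m with _ | m
  · exact h0
  · have := h m hm
    rw [Finset.Nat.sum_antidiagonal_succ, Finset.Nat.sum_antidiagonal_succ,
      sum_congr rfl fun x hx => by
        rw [ih x.2 (by have := mem_antidiagonal.1 hx; omega)
          (by have := mem_antidiagonal.1 hx; omega)]] at this
    simpa [hC] using this

end

/-! ### The explicit solution -/

section

variable {K : Type*} [Field K]

/-- The product `(1 - q ^ (2k+2)) (1 - q ^ (2k+4)) ⋯ (1 - q ^ (2k+2h))`. -/
def evenProd (q : K) (h k : ℕ) : K := ∏ i ∈ Finset.range h, (1 - q ^ (2 * k + 2 * i + 2))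

theorem evenProd_zero (q : K) (k : ℕ) : evenProd q 0 k = 1 := by simp [evenProd]

theorem evenProd_succ (q : K) (h k : ℕ) :
    evenProd q (h + 1) k = evenProd q h k * (1 - q ^ (2 * k + 2 * h + 2)) := by
  rw [evenProd, Finset.prod_range_succ, ← evenProd]

theorem evenProd_succ' (q : K) (h k : ℕ) :
    evenProd q (h + 1) k = (1 - q ^ (2 * k + 2)) * evenProd q h (k + 1) := by
  rw [evenProd, Finset.prod_range_succ', mul_comm, evenProd]
  congr 1
  exact Finset.prod_congr rfl fun i _ => by
    rw [show 2 * k + 2 * (i + 1) + 2 = 2 * (k + 1) + 2 * i + 2 by ring]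

/-- The coefficients, up to the sign `(-1)^k`, of the `q`-cosine times the generating function of
the paths from height `h` to `0`, the weight of the start included. They are `q`-analogues of the
coefficients of spherical Bessel functions. The choices `ε = 0` and `ε = 1` belong to the two
`q`-cosines. -/
def tailCoeff (ε : ℕ) (q : K) (h k : ℕ) : K :=
  q ^ ((h + 1).choose 2 + ε * (k * (2 * k + 2 * h + 1))) * evenProd q h k /
    qPoch q q (2 * h + 2 * k + 1)

/-- The coefficients, up to the sign `(-1)^k`, of the `q`-cosine times the generating function of
the paths that start at the diagonal point of height `h + 1`. -/
def diagCoeff (ε : ℕ) (q : K) (h k : ℕ) : K :=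
  q ^ ((h + 1).choose 2 + h + ε * (k * (2 * k + 2 * h + 3) + 1)) * evenProd q h k /
    qPoch q q (2 * h + 2 * k + 2)

/-- The coefficients, up to the sign `(-1)^k`, of the two `q`-analogues of the cosine. -/
def cosCoeff (ε : ℕ) (q : K) (k : ℕ) : K := q ^ (ε * (2 * k).choose 2) / qPoch q q (2 * k)

theorem choose_two_succ (h : ℕ) : (h + 1).choose 2 = h.choose 2 + h := by
  rw [Nat.choose_succ_succ' h 1, Nat.choose_one_right, add_comm]

theorem choose_two_two_mul_succ (k : ℕ) : (2 * (k + 1)).choose 2 = (k + 1) * (2 * k + 1) := by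
  rw [Nat.choose_two_right, show 2 * (k + 1) - 1 = 2 * k + 1 by omega,
    show 2 * (k + 1) * (2 * k + 1) = (k + 1) * (2 * k + 1) * 2 by ring]
  exact Nat.mul_div_cancel _ two_pos

theorem qPoch_one (q : K) : qPoch q q 1 = 1 - q := by simp [qPoch]

/-- The weight of a point off the initial run of up steps. -/
def offWeight (q : K) (h : ℕ) : K := q ^ h / (1 - q ^ (2 * h + 1))

/-- The weight of a point of the initial run of up steps; it is used for `h ≥ 1` only, so that the
subtraction does not truncate. -/
def diagWeight (ε : ℕ) (q : K) (h : ℕ) : K := q ^ (h - 1 + ε) / (1 - q ^ (2 * h))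

section

variable {q : K} {N : ℕ}

theorem one_sub_pow_ne_zero (hq : ∀ k : ℕ, 1 ≤ k → k ≤ N → q ^ k ≠ 1) {m : ℕ} (h1 : 1 ≤ m)
    (h2 : m ≤ N) : 1 - q ^ m ≠ 0 :=
  fun h => hq m h1 h2 (sub_eq_zero.1 h).symm

theorem tailCoeff_zero_zero (ε : ℕ) (q : K) : tailCoeff ε q 0 0 = offWeight q 0 := by
  simp [tailCoeff, offWeight, evenProd_zero, qPoch_one]

theorem tailCoeff_succ_zero (ε : ℕ) (hq : ∀ k : ℕ, 1 ≤ k → k ≤ N → q ^ k ≠ 1) {h : ℕ}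
    (hN : 2 * h + 3 ≤ N) :
    tailCoeff ε q (h + 1) 0 = offWeight q (h + 1) * tailCoeff ε q h 0 := by
  have e1 := qPoch_ne_zero hq (show 2 * h + 1 ≤ N by omega)
  have e2 := one_sub_pow_ne_zero hq (show 1 ≤ 2 * h + 2 by omega) (by omega)
  have e3 := one_sub_pow_ne_zero hq (show 1 ≤ 2 * h + 3 by omega) (by omega)
  have e4 : qPoch q q (2 * (h + 1) + 2 * 0 + 1) =
      qPoch q q (2 * h + 1) * (1 - q ^ (2 * h + 2)) * (1 - q ^ (2 * h + 3)) := by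
    rw [← qPoch_succ, ← qPoch_succ]
    rfl
  rw [tailCoeff, tailCoeff, offWeight, evenProd_succ, choose_two_succ (h + 1), e4]
  simp only [mul_zero, zero_mul, add_zero, zero_add]
  rw [show 2 * (h + 1) + 1 = 2 * h + 3 by ring]
  field_simp
  ring

theorem tailCoeff_zero_succ {ε : ℕ} (hε : ε = 0 ∨ ε = 1)
    (hq : ∀ k : ℕ, 1 ≤ k → k ≤ N → q ^ k ≠ 1) {k : ℕ} (hN : 2 * k + 3 ≤ N) :
    tailCoeff ε q 0 (k + 1) = offWeight q 0 * (cosCoeff ε q (k + 1) - tailCoeff ε q 1 k) := by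
  have e1 := qPoch_ne_zero hq (show 2 * k + 2 ≤ N by omega)
  have e2 := one_sub_pow_ne_zero hq (show 1 ≤ 1 by omega) (by omega)
  have e3 := one_sub_pow_ne_zero hq (show 1 ≤ 2 * k + 3 by omega) (by omega)
  rw [tailCoeff, tailCoeff, offWeight, cosCoeff, evenProd_zero, evenProd_succ, evenProd_zero,
    choose_two_two_mul_succ,
    show 2 * 0 + 2 * (k + 1) + 1 = 2 * k + 2 + 1 by ring,
    show 2 * 1 + 2 * k + 1 = 2 * k + 2 + 1 by ring, qPoch_succ,
    show 2 * (k + 1) = 2 * k + 2 by ring, show 2 * k + 2 + 1 = 2 * k + 3 by ring,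
    show 2 * 0 + 1 = 1 by ring, show 2 * k + 2 * 0 + 2 = 2 * k + 2 by ring]
  rcases hε with rfl | rfl <;> norm_num [Nat.choose] at e2 ⊢ <;> field_simp <;> ring

theorem tailCoeff_succ_succ {ε : ℕ} (hε : ε = 0 ∨ ε = 1)
    (hq : ∀ k : ℕ, 1 ≤ k → k ≤ N → q ^ k ≠ 1) {h k : ℕ} (hN : 2 * h + 2 * k + 5 ≤ N) :
    tailCoeff ε q (h + 1) (k + 1) =
      offWeight q (h + 1) * (tailCoeff ε q h (k + 1) - tailCoeff ε q (h + 2) k) := by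
  have e1 := qPoch_ne_zero hq (show 2 * h + 2 * k + 3 ≤ N by omega)
  have e2 := one_sub_pow_ne_zero hq (show 1 ≤ 2 * h + 2 * k + 4 by omega) (by omega)
  have e3 := one_sub_pow_ne_zero hq (show 1 ≤ 2 * h + 2 * k + 5 by omega) (by omega)
  have e4 := one_sub_pow_ne_zero hq (show 1 ≤ 2 * h + 3 by omega) (by omega)
  rw [tailCoeff, tailCoeff, tailCoeff, offWeight, evenProd_succ' q (h + 1),
    evenProd_succ q h (k + 1), choose_two_succ (h + 2), choose_two_succ (h + 1),
    show 2 * (h + 1) + 2 * (k + 1) + 1 = 2 * h + 2 * k + 3 + 1 + 1 by ring,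
    show 2 * (h + 2) + 2 * k + 1 = 2 * h + 2 * k + 3 + 1 + 1 by ring, qPoch_succ, qPoch_succ,
    show 2 * h + 2 * (k + 1) + 1 = 2 * h + 2 * k + 3 by ring,
    show 2 * (k + 1) + 2 * h + 2 = 2 * h + 2 * k + 4 by ring,
    show 2 * h + 2 * k + 3 + 1 = 2 * h + 2 * k + 4 by ring,
    show 2 * h + 2 * k + 4 + 1 = 2 * h + 2 * k + 5 by ring,
    show 2 * (h + 1) + 1 = 2 * h + 3 by ring]
  rcases hε with rfl | rfl <;> field_simp <;> ring

theorem diagCoeff_zero {ε : ℕ} (hq : ∀ k : ℕ, 1 ≤ k → k ≤ N → q ^ k ≠ 1) {h : ℕ}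
    (hN : 2 * h + 2 ≤ N) :
    diagCoeff ε q h 0 = diagWeight ε q (h + 1) * tailCoeff ε q h 0 := by
  have e1 := qPoch_ne_zero hq (show 2 * h + 1 ≤ N by omega)
  have e2 := one_sub_pow_ne_zero hq (show 1 ≤ 2 * h + 2 by omega) (by omega)
  rw [diagCoeff, diagWeight, tailCoeff, show 2 * h + 2 * 0 + 2 = 2 * h + 1 + 1 by ring, qPoch_succ,
    show 2 * h + 2 * 0 + 1 = 2 * h + 1 by ring, show 2 * h + 1 + 1 = 2 * h + 2 by ring,
    show 2 * (h + 1) = 2 * h + 2 by ring, Nat.add_sub_cancel]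
  field_simp
  ring

theorem diagCoeff_succ {ε : ℕ} (hε : ε = 0 ∨ ε = 1) (hq : ∀ k : ℕ, 1 ≤ k → k ≤ N → q ^ k ≠ 1)
    {h k : ℕ} (hN : 2 * h + 2 * k + 4 ≤ N) :
    diagCoeff ε q h (k + 1) =
      diagWeight ε q (h + 1) * (tailCoeff ε q h (k + 1) - diagCoeff ε q (h + 1) k) := by
  have e1 := qPoch_ne_zero hq (show 2 * h + 2 * k + 3 ≤ N by omega)
  have e2 := one_sub_pow_ne_zero hq (show 1 ≤ 2 * h + 2 * k + 4 by omega) (by omega)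
  have e3 := one_sub_pow_ne_zero hq (show 1 ≤ 2 * h + 2 by omega) (by omega)
  rw [diagCoeff, diagCoeff, tailCoeff, diagWeight, evenProd_succ', choose_two_succ (h + 1),
    show 2 * h + 2 * (k + 1) + 2 = 2 * h + 2 * k + 3 + 1 by ring,
    show 2 * (h + 1) + 2 * k + 2 = 2 * h + 2 * k + 3 + 1 by ring, qPoch_succ,
    show 2 * h + 2 * (k + 1) + 1 = 2 * h + 2 * k + 3 by ring,
    show 2 * h + 2 * k + 3 + 1 = 2 * h + 2 * k + 4 by ring,
    show 2 * (h + 1) = 2 * h + 2 by ring, Nat.add_sub_cancel]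
  rcases hε with rfl | rfl <;> field_simp <;> ring

theorem diagCoeff_zero_left (ε : ℕ) (q : K) (k : ℕ) : diagCoeff ε q 0 k = cosCoeff ε q (k + 1) := by
  rw [diagCoeff, cosCoeff, evenProd_zero, choose_two_two_mul_succ,
    show 2 * 0 + 2 * k + 2 = 2 * (k + 1) by ring,
    show Nat.choose (0 + 1) 2 + 0 + ε * (k * (2 * k + 2 * 0 + 3) + 1) =
      ε * ((k + 1) * (2 * k + 1)) by
      rw [show Nat.choose (0 + 1) 2 = 0 from rfl]; ring, mul_one]

end

open Finset in
/-- The Dyck path sums and the Euler numbers are both inverse to the series of `cosCoeff`. -/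
theorem pathSum_eq_patternSum {ε n : ℕ} (hε : ε = 0 ∨ ε = 1) {q : K}
    (hq : ∀ k : ℕ, 1 ≤ k → k ≤ 2 * n → q ^ k ≠ 1) {W : ℕ → ℕ → K} {s : ℕ → Prop}
    (hW : ∀ i h, h < i → W i h = offWeight q h)
    (hWd : ∀ h, W (h + 1) (h + 1) = diagWeight ε q (h + 1))
    (hs : ∀ j, s (2 * j) ↔ s 0) (hs' : ∀ j, s (2 * j + 1) ↔ ¬s 0)
    (hconst : ∀ m, patternSum m (fun _ => s 0) q = q ^ (ε * m.choose 2)) :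
    pathSum W (2 * n) 0 0 = patternSum (2 * n) s q / qPoch q q (2 * n) := by
  have h0 : cosCoeff ε q 0 = 1 := by simp [cosCoeff, qPoch]
  have hp0 : patternSum 0 s q = 1 := by
    rw [patternSum_congr (r' := fun _ => s 0) (fun j hj => by omega), hconst]; simp
  refine eq_of_signed_conv (C := cosCoeff ε q) (A := fun m => pathSum W (2 * m) 0 0)
    (B := fun m => patternSum (2 * m) s q / qPoch q q (2 * m)) h0 ?_ (fun k hk => ?_) n le_rfl
  · simp [pathSum_zero_zero, hp0, qPoch]
  · rw [signed_conv_dyck (d := tailCoeff ε q) (g := fun h => diagCoeff ε q (h - 1)) (N := 2 * n)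
      hW hWd h0 (fun _ => tailCoeff_zero_zero ε q) (fun h => tailCoeff_succ_zero ε hq)
      (fun k => tailCoeff_zero_succ hε hq) (fun h k => tailCoeff_succ_succ hε hq)
      (fun h => diagCoeff_zero hq) (fun h k => diagCoeff_succ hε hq)
      (fun k _ => diagCoeff_zero_left ε q k) k (by omega)]
    have := sum_range_patternSum (k + 1) (by omega) s hs hs' q fun j h1 h2 => hq j h1 (by omega)
    rw [Finset.Nat.sum_antidiagonal_eq_sum_range_succ_mk, ← this]
    exact Finset.sum_congr rfl fun j _ => by rw [hconst, cosCoeff]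

end

theorem mainTheorem2 {K : Type*} [Field K] (n : ℕ) (q : K)
    (hq : ∀ k : ℕ, 1 ≤ k → k ≤ 2 * n → q ^ k ≠ 1) :
    (∑ d : {d : DyckWord // d.semilength = n}, ∏ i ∈ Finset.Icc 1 (2 * n),
        q ^ dyckHeight d.1 i /
          (1 - q ^ (2 * dyckHeight d.1 i + 1 - kroneckerDelta (dyckHeight d.1 i) i))
      = qEulerStar (2 * n) q / qPoch q q (2 * n)) ∧
    (∑ d : {d : DyckWord // d.semilength = n}, ∏ i ∈ Finset.Icc 1 (2 * n),
        q ^ (dyckHeight d.1 i - kroneckerDelta (dyckHeight d.1 i) i) /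
          (1 - q ^ (2 * dyckHeight d.1 i + 1 - kroneckerDelta (dyckHeight d.1 i) i))
      = qEuler (2 * n) q / qPoch q q (2 * n)) := by
  constructor
  · rw [sum_dyckWord_eq_pathSum
      (fun i h => q ^ h / (1 - q ^ (2 * h + 1 - kroneckerDelta h i))), qEulerStar_eq_patternSum]
    refine pathSum_eq_patternSum (Or.inr rfl) hq (fun i h hi => ?_) (fun h => ?_) (fun j => ?_)
      (fun j => ?_) (fun m => ?_)
    · simp [kroneckerDelta, offWeight, hi.ne]
    · simp [kroneckerDelta, diagWeight]
    · simp
    · simp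
    · simpa using patternSum_true m q
  · rw [sum_dyckWord_eq_pathSum
      (fun i h => q ^ (h - kroneckerDelta h i) / (1 - q ^ (2 * h + 1 - kroneckerDelta h i))),
      qEuler_eq_patternSum]
    refine pathSum_eq_patternSum (Or.inl rfl) hq (fun i h hi => ?_) (fun h => ?_) (fun j => ?_)
      (fun j => ?_) (fun m => ?_)
    · simp [kroneckerDelta, offWeight, hi.ne]
    · simp [kroneckerDelta, diagWeight]
    · simp
    · simp
    · simpa using patternSum_false m q
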